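/- Let $\Gamma_1$ be an equilateral triangle (three vertices, three edges) with a horizontal bottom side and its apex on top. For $n\ge 1$ let $\Gamma_{n+1}$ be the graph obtained by partitioning an equilateral triangle (in the same position) into four equal smaller triangles and putting a copy of $\Gamma_n$ in each of the three corner triangles, where the copies share the midpoints of the sides of the large triangle as common vertices (the graphs $\Gamma_n$ are the Sierpiński graphs). Give every edge of $\Gamma_n$ its directional label: $a$ if the edge points up from left to right, $b$ if it is horizontal, and $c$ if it points down from left to right. The weight of a subgraph is the product of the labels of its edges, and the weighted generating function of a family of subgraphs is the sum of their weights; it is a polynomial in $a,b,c$, and the identities below are identities of polynomials, valid for all elements $a,b,c$ of an arbitrary commutative ring, in particular for positive reals. A spanning $k$-forest of a graph is an acyclic subgraph that contains all the vertices and has exactly $k$ connected components; a spanning tree is a spanning $1$-forest. Let - $T_n$ be the weighted generating function of the spanning trees of $\Gamma_n$; - $U_n$ (respectively $R_n$, $L_n$) be that of the spanning $2$-forests of $\Gamma_n$ in which the upmost (respectively rightmost, leftmost) vertex lies in one component and the two other outmost (corner) vertices lie together in the other component; - $Q_n$ be that of the spanning $3$-forests of $\Gamma_n$ in which the three outmost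 vertices lie in three different components. Then for every $n\ge 1$ $$T_{n+1}=2T_n^2(U_n+R_n+L_n),$$ $$U_{n+1}=T_nU_n(2R_n+2L_n+3U_n)+T_n^2Q_n,$$ $$R_{n+1}=T_nR_n(2L_n+2U_n+3R_n)+T_n^2Q_n,$$ $$L_{n+1}=T_nL_n(2R_n+2U_n+3L_n)+T_n^2Q_n,$$ $$Q_{n+1}=4T_nQ_n(U_n+R_n+L_n)+2\bigl(U_n^2(R_n+L_n)+R_n^2(L_n+U_n)+L_n^2(R_n+U_n)\bigr)+2U_nR_nL_n,$$ with the initial values $$T_1=ab+ac+bc,\qquad U_1=b,\qquad R_1=a,\qquad L_1=c,\qquad Q_1=1.$$ -/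

import Mathlib

/-! Weighted generating functions of spanning trees and spanning forests of a finite graph. -/

namespace SpanningGF

/-- `H` is a spanning tree of `G`; a spanning subgraph is a graph `H ≤ G` on all the vertices. -/
def IsSpanningTree {V : Type*} (G H : SimpleGraph V) : Prop :=
  H ≤ G ∧ H.IsTree

/-- `H` is a spanning `k`-forest of `G`: a spanning subgraph without cycles that has exactly
`k` connected components. -/
def IsSpanningForest {V : Type*} (G : SimpleGraph V) (k : ℕ) (H : SimpleGraph V) : Prop :=
  H ≤ G ∧ H.IsAcyclic ∧ Nat.card H.ConnectedComponent = k

open Classical in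
/-- The weight of a graph: the product of the weights of its edges. -/
noncomputable def weight {V K : Type*} [Fintype V] [CommRing K] (w : Sym2 V → K)
    (H : SimpleGraph V) : K :=
  ∏ e ∈ H.edgeFinset, w e

open Classical in
/-- The weighted generating function of the graphs `H` on the vertex set `V` with property `P`. -/
noncomputable def genFun {V K : Type*} [Fintype V] [CommRing K] (w : Sym2 V → K)
    (P : SimpleGraph V → Prop) : K :=
  ∑ H : SimpleGraph V with P H, weight w H

end SpanningGF

/-! The Sierpiński graphs. The pair `(i, j)` stands for the point `i • (1, 0) + j • (1/2, √3/2)`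
of the plane, in the triangular lattice with elementary triangles of side `1`. -/

namespace Sierpinski

/-- The vertices of the Sierpiński graph of side `2 ^ k`: the three vertices of an elementary
triangle for `k = 0`; then three copies, put in the corners of a triangle of doubled side. -/
def vertices : ℕ → Finset (ℕ × ℕ)
  | 0 => {(0, 0), (1, 0), (0, 1)}
  | k + 1 => vertices k
      ∪ (vertices k).image (fun p => p + (2 ^ k, 0))
      ∪ (vertices k).image (fun p => p + (0, 2 ^ k))

/-- The edges of the Sierpiński graph of side `2 ^ k`. -/
def edges : ℕ → Finset (Sym2 (ℕ × ℕ))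
  | 0 => {s((0, 0), (1, 0)), s((0, 0), (0, 1)), s((0, 1), (1, 0))}
  | k + 1 => edges k
      ∪ (edges k).image (Sym2.map (fun p => p + (2 ^ k, 0)))
      ∪ (edges k).image (Sym2.map (fun p => p + (0, 2 ^ k)))

theorem left_mem (k : ℕ) : ((0, 0) : ℕ × ℕ) ∈ vertices k := by
  induction k with
  | zero => simp [vertices]
  | succ k ih => simp [vertices, ih]

theorem right_mem (k : ℕ) : ((2 ^ k, 0) : ℕ × ℕ) ∈ vertices k := by
  induction k with
  | zero => simp [vertices]
  | succ k ih =>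
    simp only [vertices, Finset.mem_union, Finset.mem_image]
    exact Or.inl (Or.inr ⟨_, ih, by ext <;> simp [pow_succ, mul_two]⟩)

theorem up_mem (k : ℕ) : ((0, 2 ^ k) : ℕ × ℕ) ∈ vertices k := by
  induction k with
  | zero => simp [vertices]
  | succ k ih =>
    simp only [vertices, Finset.mem_union, Finset.mem_image]
    exact Or.inr ⟨_, ih, by ext <;> simp [pow_succ, mul_two]⟩

/-- The Sierpiński graph of side `2 ^ k`, as a graph on its finite vertex set. -/
def gasket (k : ℕ) : SimpleGraph (vertices k) :=
  (SimpleGraph.fromEdgeSet (edges k : Set (Sym2 (ℕ × ℕ)))).comap Subtype.val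

/-- Both end points of each of the listed edges are vertices. -/
theorem mem_vertices_of_mem_edges (k : ℕ) :
    ∀ e ∈ edges k, ∀ p ∈ e, p ∈ vertices k := by
  induction k with
  | zero => simp [edges, vertices]; grind
  | succ k ih =>
    intro e he p hp
    simp only [edges, Finset.mem_union, Finset.mem_image] at he
    simp only [vertices, Finset.mem_union, Finset.mem_image]
    rcases he with (he | ⟨f, hf, rfl⟩) | ⟨f, hf, rfl⟩
    · exact Or.inl (Or.inl (ih e he p hp))
    · obtain ⟨q, hq, rfl⟩ := Sym2.mem_map.1 hp
      exact Or.inl (Or.inr ⟨q, ih f hf q hq, rfl⟩)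
    · obtain ⟨q, hq, rfl⟩ := Sym2.mem_map.1 hp
      exact Or.inr ⟨q, ih f hf q hq, rfl⟩

/-- The leftmost vertex. -/
def left (k : ℕ) : vertices k := ⟨(0, 0), left_mem k⟩

/-- The rightmost vertex. -/
def right (k : ℕ) : vertices k := ⟨(2 ^ k, 0), right_mem k⟩

/-- The upmost vertex. -/
def up (k : ℕ) : vertices k := ⟨(0, 2 ^ k), up_mem k⟩

/-- The label of an edge of the triangular lattice, according to its direction: `b` for a
horizontal edge (equal second coordinates), `a` for an edge pointing up from left to right (equal
first coordinates), `c` for an edge pointing down from left to right. -/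
def label {K : Type*} (a b c : K) : Sym2 (ℕ × ℕ) → K :=
  Sym2.lift ⟨fun p q => if p.2 = q.2 then b else if p.1 = q.1 then a else c, by
    intro p q
    simp only [eq_comm]⟩

/-- The directional labelling of the Sierpiński graph of side `2 ^ k`. -/
def dirLabel {K : Type*} (a b c : K) (k : ℕ) (e : Sym2 (vertices k)) : K :=
  label a b c (e.map Subtype.val)

/-! The generating functions. For `n ≥ 1` the `n`-th graph `Γ_n` has side `2 ^ (n - 1)`, so that
`Γ_1` is a triangle; the value `n = 0` is not used. -/

open SpanningGF

/-- Spanning trees of `Γ_n`. -/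
noncomputable def T {K : Type*} [CommRing K] (a b c : K) (n : ℕ) : K :=
  genFun (dirLabel a b c (n - 1)) (fun H => IsSpanningTree (gasket (n - 1)) H)

/-- Spanning `2`-forests of `Γ_n` with the leftmost and the rightmost vertex in one component and
the upmost vertex in the other one. -/
noncomputable def U {K : Type*} [CommRing K] (a b c : K) (n : ℕ) : K :=
  genFun (dirLabel a b c (n - 1)) (fun H => IsSpanningForest (gasket (n - 1)) 2 H ∧
    H.Reachable (left (n - 1)) (right (n - 1)) ∧ ¬ H.Reachable (left (n - 1)) (up (n - 1)))

/-- Spanning `2`-forests of `Γ_n` with the leftmost and the upmost vertex in one component and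
the rightmost vertex in the other one. -/
noncomputable def R {K : Type*} [CommRing K] (a b c : K) (n : ℕ) : K :=
  genFun (dirLabel a b c (n - 1)) (fun H => IsSpanningForest (gasket (n - 1)) 2 H ∧
    H.Reachable (left (n - 1)) (up (n - 1)) ∧ ¬ H.Reachable (left (n - 1)) (right (n - 1)))

/-- Spanning `2`-forests of `Γ_n` with the rightmost and the upmost vertex in one component and
the leftmost vertex in the other one. -/
noncomputable def L {K : Type*} [CommRing K] (a b c : K) (n : ℕ) : K :=
  genFun (dirLabel a b c (n - 1)) (fun H => IsSpanningForest (gasket (n - 1)) 2 H ∧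
    H.Reachable (right (n - 1)) (up (n - 1)) ∧ ¬ H.Reachable (right (n - 1)) (left (n - 1)))

/-- Spanning `3`-forests of `Γ_n` with the leftmost, the rightmost and the upmost vertex in three
different components. -/
noncomputable def Q {K : Type*} [CommRing K] (a b c : K) (n : ℕ) : K :=
  genFun (dirLabel a b c (n - 1)) (fun H => IsSpanningForest (gasket (n - 1)) 3 H ∧
    ¬ H.Reachable (left (n - 1)) (right (n - 1)) ∧ ¬ H.Reachable (left (n - 1)) (up (n - 1)) ∧
    ¬ H.Reachable (right (n - 1)) (up (n - 1)))

end Sierpinski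

/-!
The copies of `Γ_n` in `Γ_{n+1}` share nothing but hubs: each of the six hubs is a corner of a copy.
A subgraph of `Γ_{n+1}` is a triple of subgraphs of the copies, its weight is the product of their
weights, and reachability between hubs is generated by reachability between the corners within the
copies. Since a graph `H` on `V` is acyclic if and only if `|E(H)| + |components of H| = |V|`,
whether the triple is a forest each of whose components contains a corner of `Γ_{n+1}`, and how it
connects these corners, depends only on the partitions that the three forests induce on the
corners of the copies. So every generating function at stage `n + 1` is a sum of products of three
generating functions at stage `n`, over a finite set of triples of partitions that can be
enumerated. Gluing three single edges gives the initial values in the same way.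
-/

namespace SpanningGF

section PairSetoid

variable {α β : Type*}

lemma card_quotient_ker (f : α → β) : Nat.card (Quotient (Setoid.ker f)) = (Set.range f).ncard :=
  Nat.card_congr (Setoid.quotientKerEquivRange f)

lemma card_quotient_comap_eq_iff [Finite α] {s : Setoid α} {t : β → α} :
    Nat.card (Quotient (s.comap t)) = Nat.card (Quotient s) ↔ ∀ x, ∃ i, s x (t i) := by
  let f : Quotient (s.comap t) → Quotient s := Quotient.map t fun _ _ h => h
  have hf : f.Injective := by
    rintro ⟨i⟩ ⟨j⟩ h
    exact Quotient.sound (s := s.comap t) (Quotient.exact (s := s) h)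
  have hf_surj : f.Surjective ↔ ∀ x, ∃ i, s x (t i) := by
    refine ⟨fun h x => ?_, fun h => ?_⟩
    · obtain ⟨⟨i⟩, hi⟩ := h ⟦x⟧
      exact ⟨i, s.symm (Quotient.exact hi)⟩
    · rintro ⟨x⟩
      obtain ⟨i, hi⟩ := h x
      exact ⟨⟦i⟧, Quotient.sound (s.symm hi)⟩
  rw [← hf_surj]
  exact ⟨fun h => (hf.bijective_of_nat_card_le h.ge).2,
    fun h => Nat.card_congr (Equiv.ofBijective f ⟨hf, h⟩)⟩

/-- The equivalence relation generated by a list of pairs. -/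
def pairSetoid (l : List (α × α)) : Setoid α :=
  Relation.EqvGen.setoid fun x y => (x, y) ∈ l

lemma pairSetoid_le_iff {l : List (α × α)} {s : Setoid α} :
    pairSetoid l ≤ s ↔ ∀ x y, (x, y) ∈ l → s x y :=
  Setoid.gi.gc _ s

/-- The labelling obtained from `f` by giving the points labelled `f y` the label `f x`: its
kernel identifies `x` and `y` in addition to the points identified by `f`. -/
def mergeLabels [DecidableEq β] (f : α → β) (x y : α) (z : α) : β :=
  if f z = f y then f x else f z

lemma ker_mergeLabels_le_iff [DecidableEq β] {f : α → β} {x y : α} {s : Setoid α} :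
    Setoid.ker (mergeLabels f x y) ≤ s ↔ Setoid.ker f ≤ s ∧ s x y := by
  refine ⟨fun h => ⟨fun u v (huv : f u = f v) => h ?_, h ?_⟩, fun ⟨hf, hxy⟩ u v huv => ?_⟩
  · simp only [Setoid.ker_def, mergeLabels, huv]
  · simp only [Setoid.ker_def, mergeLabels, ite_self, if_true]
  · have to_x : ∀ {z}, f z = f y → s z x := fun hz => s.trans (hf hz) (s.symm hxy)
    simp only [Setoid.ker_def, mergeLabels] at huv
    split_ifs at huv with hu hv hv
    · exact s.trans (to_x hu) (s.symm (to_x hv))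
    · exact s.trans (to_x hu) (hf huv)
    · exact s.trans (hf huv) (s.symm (to_x hv))
    · exact hf huv

lemma range_mergeLabels [DecidableEq β] {f : α → β} {x y : α} (hxy : f x ≠ f y) :
    Set.range (mergeLabels f x y) = Set.range f \ {f y} := by
  ext b
  constructor
  · rintro ⟨z, rfl⟩
    by_cases hz : f z = f y
    · simp only [mergeLabels, hz, if_true]
      exact ⟨⟨x, rfl⟩, hxy⟩
    · simp only [mergeLabels, hz, if_false]
      exact ⟨⟨z, rfl⟩, hz⟩
  · rintro ⟨⟨z, rfl⟩, hz⟩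
    exact ⟨z, if_neg hz⟩

lemma card_quotient_ker_mergeLabels [Finite α] [DecidableEq β] {f : α → β} {x y : α}
    (hxy : f x ≠ f y) :
    Nat.card (Quotient (Setoid.ker (mergeLabels f x y))) + 1
      = Nat.card (Quotient (Setoid.ker f)) := by
  rw [card_quotient_ker, card_quotient_ker, range_mergeLabels hxy]
  exact Set.ncard_sdiff_singleton_add_one ⟨y, rfl⟩ (Set.finite_range f)

variable [DecidableEq α]

/-- A labelling of the points by points, with kernel `pairSetoid l`; it makes that relation
decidable. -/
def pairLabel : List (α × α) → α → α
  | [] => id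
  | e :: l => mergeLabels (pairLabel l) e.1 e.2

lemma ker_pairLabel (l : List (α × α)) : Setoid.ker (pairLabel l) = pairSetoid l := by
  refine eq_of_forall_ge_iff fun s => ?_
  rw [pairSetoid_le_iff]
  induction l with
  | nil =>
    simp only [List.not_mem_nil, false_imp_iff, implies_true, iff_true]
    rintro x y rfl
    exact s.refl _
  | cons e l ih =>
    rw [pairLabel, ker_mergeLabels_le_iff, ih, and_comm]
    simp only [List.mem_cons, or_imp, forall_and, Prod.ext_iff, and_imp, forall_eq_apply_imp_iff,
      forall_eq]

instance (l : List (α × α)) : DecidableRel (pairSetoid l) :=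
  fun x y => decidable_of_iff (pairLabel l x = pairLabel l y) (by rw [← ker_pairLabel]; rfl)

lemma card_quotient_pairSetoid [Fintype α] (l : List (α × α)) :
    Nat.card (Quotient (pairSetoid l)) = (Finset.univ.image (pairLabel l)).card := by
  rw [← ker_pairLabel, card_quotient_ker, ← Set.ncard_coe_finset, Finset.coe_image,
    Finset.coe_univ, Set.image_univ]

end PairSetoid

section Forest

variable {V : Type*} {H : SimpleGraph V}

lemma reachableSetoid_le_iff {s : Setoid V} :
    H.reachableSetoid ≤ s ↔ ∀ u v, H.Adj u v → s u v := by
  refine ⟨fun h u v huv => h huv.reachable, fun h u v huv => ?_⟩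
  obtain ⟨p⟩ : H.Reachable u v := huv
  induction p with
  | nil => exact s.refl _
  | cons huv _ ih => exact s.trans' (h _ _ huv) ih

open Classical in
lemma reachableSetoid_sup_edge (u v : V) :
    (H ⊔ SimpleGraph.edge u v).reachableSetoid
      = Setoid.ker (mergeLabels H.connectedComponentMk u v) := by
  refine eq_of_forall_ge_iff fun s => ?_
  have h_ker : Setoid.ker H.connectedComponentMk = H.reachableSetoid :=
    Setoid.ker_mk_eq H.reachableSetoid
  rw [ker_mergeLabels_le_iff, h_ker, reachableSetoid_le_iff, reachableSetoid_le_iff]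
  simp only [SimpleGraph.sup_adj, SimpleGraph.edge_adj, or_imp, forall_and]
  refine and_congr_right fun _ => ⟨fun h => ?_, fun h x y => ?_⟩
  · by_cases huv : u = v
    · exact huv ▸ s.refl _
    · exact h u v ⟨Or.inl ⟨rfl, rfl⟩, huv⟩
  · rintro ⟨⟨rfl, rfl⟩ | ⟨rfl, rfl⟩, -⟩
    exacts [h, s.symm h]

lemma card_connectedComponent_sup_edge [Finite V] {u v : V} (huv : ¬ H.Reachable u v) :
    Nat.card (H ⊔ SimpleGraph.edge u v).ConnectedComponent + 1
      = Nat.card H.ConnectedComponent := by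
  classical
  have h_ker : Setoid.ker H.connectedComponentMk = H.reachableSetoid :=
    Setoid.ker_mk_eq H.reachableSetoid
  have h_card := card_quotient_ker_mergeLabels (mt SimpleGraph.ConnectedComponent.exact huv)
  rwa [← reachableSetoid_sup_edge, h_ker] at h_card

lemma ncard_edgeSet_add_card_connectedComponent_of_isAcyclic [Finite V] (hH : H.IsAcyclic) :
    H.edgeSet.ncard + Nat.card H.ConnectedComponent = Nat.card V := by
  induction hn : H.edgeSet.ncard generalizing H with
  | zero =>
    have h_mk : Function.Injective H.connectedComponentMk := by
      obtain rfl : H = ⊥ := by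
        rwa [Set.ncard_eq_zero (Set.toFinite _), SimpleGraph.edgeSet_eq_empty] at hn
      exact fun u v huv => SimpleGraph.reachable_bot.1 (SimpleGraph.ConnectedComponent.exact huv)
    rw [zero_add, Nat.card_congr (Equiv.ofBijective _ ⟨h_mk, Quot.mk_surjective⟩)]
  | succ n ih =>
    obtain ⟨⟨u, v⟩, huv⟩ := Set.nonempty_of_ncard_ne_zero (hn.trans_ne n.succ_ne_zero)
    have h_sup : H.deleteEdges {s(u, v)} ⊔ SimpleGraph.edge u v = H := by
      rw [SimpleGraph.deleteEdges, SimpleGraph.edge]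
      exact sdiff_sup_cancel ((SimpleGraph.edge_le_iff _).2 (Or.inr huv))
    have h_bridge : ¬ (H.deleteEdges {s(u, v)}).Reachable u v :=
      SimpleGraph.isAcyclic_iff_forall_isBridge.1 hH huv
    have h_edges : (H.deleteEdges {s(u, v)}).edgeSet.ncard = n := by
      rw [SimpleGraph.edgeSet_deleteEdges, Set.ncard_sdiff_singleton_of_mem huv, hn,
        Nat.add_sub_cancel]
    have h_comp := card_connectedComponent_sup_edge h_bridge
    rw [h_sup] at h_comp
    have := ih (hH.anti (H.deleteEdges_le _)) h_edges
    omega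

lemma isAcyclic_iff_ncard_edgeSet_add_card_connectedComponent [Finite V] :
    H.IsAcyclic ↔ H.edgeSet.ncard + Nat.card H.ConnectedComponent = Nat.card V := by
  refine ⟨ncard_edgeSet_add_card_connectedComponent_of_isAcyclic, fun h => ?_⟩
  obtain ⟨F, hFH, hF, hreach⟩ := H.exists_isAcyclic_reachable_eq_le
  have h_comp : F.ConnectedComponent = H.ConnectedComponent :=
    congrArg Quot hreach
  have h_card := ncard_edgeSet_add_card_connectedComponent_of_isAcyclic hF
  rw [h_comp] at h_card
  have h_edges : F.edgeSet = H.edgeSet :=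
    Set.eq_of_subset_of_ncard_le (SimpleGraph.edgeSet_mono hFH) (by omega)
  rwa [← SimpleGraph.edgeSet_injective h_edges]

end Forest

section RootedForest

variable {V ι K : Type*} [CommRing K] {G H : SimpleGraph V} {t : ι → V} {r : Setoid ι}

/-- `H` is a spanning forest of `G` in which every component contains one of the terminals `t i`,
two terminals being connected if and only if their indices are related by `r`. -/
structure IsRootedForest (G : SimpleGraph V) (t : ι → V) (r : Setoid ι) (H : SimpleGraph V) :
    Prop where
  le : H ≤ G
  isAcyclic : H.IsAcyclic
  exists_reachable : ∀ v, ∃ i, H.Reachable v (t i)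
  comap_reachable : H.reachableSetoid.comap t = r

lemma card_connectedComponent_eq_iff [Finite V] :
    Nat.card H.ConnectedComponent = Nat.card (Quotient (H.reachableSetoid.comap t))
      ↔ ∀ v, ∃ i, H.Reachable v (t i) :=
  eq_comm.trans card_quotient_comap_eq_iff

lemma isRootedForest_iff_isSpanningForest [Finite V] :
    IsRootedForest G t r H
      ↔ IsSpanningForest G (Nat.card (Quotient r)) H ∧ H.reachableSetoid.comap t = r := by
  constructor
  · rintro ⟨hle, hacyc, hroot, rfl⟩
    exact ⟨⟨hle, hacyc, card_connectedComponent_eq_iff.2 hroot⟩, rfl⟩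
  · rintro ⟨⟨hle, hacyc, hcard⟩, rfl⟩
    exact ⟨hle, hacyc, card_connectedComponent_eq_iff.1 hcard, rfl⟩

lemma isRootedForest_top_iff_isSpanningTree [Nonempty ι] :
    IsRootedForest G t ⊤ H ↔ IsSpanningTree G H := by
  constructor
  · intro hH
    have h_terminal (i j : ι) : H.Reachable (t i) (t j) :=
      Setoid.ext_iff.1 hH.comap_reachable i j |>.2 trivial
    have : Nonempty V := Nonempty.map t inferInstance
    refine ⟨hH.le, SimpleGraph.Connected.mk fun u v => ?_, hH.isAcyclic⟩
    obtain ⟨i, hi⟩ := hH.exists_reachable u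
    obtain ⟨j, hj⟩ := hH.exists_reachable v
    exact hi.trans ((h_terminal i j).trans hj.symm)
  · rintro ⟨hle, hconn, hacyc⟩
    exact ⟨hle, hacyc, fun v => ⟨Classical.arbitrary ι, hconn.preconnected _ _⟩,
      eq_top_iff.2 fun _ _ _ => hconn.preconnected _ _⟩

lemma weight_eq_finprod [Fintype V] (w : Sym2 V → K) (H : SimpleGraph V) :
    weight w H = ∏ᶠ e ∈ H.edgeSet, w e := by
  classical rw [weight, ← SimpleGraph.coe_edgeFinset, finprod_mem_coe_finset]

lemma genFun_eq_weight [Fintype V] {w : Sym2 V → K} {P : SimpleGraph V → Prop}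
    (hP : ∀ H', P H' ↔ H' = H) : genFun w P = weight w H := by
  classical
  simp only [genFun, hP, Finset.sum_filter, Finset.sum_ite_eq', Finset.mem_univ, if_true]

/-- The weighted generating function of the spanning forests rooted at the terminals `t` that
connect them according to `r`. -/
noncomputable def rootedGF [Fintype V] (G : SimpleGraph V) (t : ι → V) (w : Sym2 V → K)
    (r : Setoid ι) : K :=
  genFun w (IsRootedForest G t r)

end RootedForest

section Gluing

variable {κ ι P W O : Type*} {V : κ → Type*}

/-- The type `W` is obtained from the types `V i`, each with terminals `t i`, by identifying
terminals: the terminals become the hubs `h p`, and the terminal `a` of the `i`-th piece is glued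
to the hub `hub i a`. Two pieces share at most one hub, and nothing else. -/
structure IsGluing (f : ∀ i, V i ↪ W) (t : ∀ i, ι → V i) (h : P ↪ W) (hub : κ → ι → P) :
    Prop where
  exists_eq : ∀ w, ∃ i v, f i v = w
  apply_terminal : ∀ i a, f i (t i a) = h (hub i a)
  exists_terminal : ∀ {i j}, i ≠ j → ∀ u v, f i u = f j v → ∃ a, t i a = u
  hub_injective : ∀ i, (hub i).Injective
  hub_surjective : ∀ p, ∃ i a, hub i a = p
  subsingleton_inter : ∀ {i j}, i ≠ j → (Set.range (hub i) ∩ Set.range (hub j)).Subsingleton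

/-- The union in `W` of graphs on the pieces `V i`. -/
def glue (f : ∀ i, V i ↪ W) (H : ∀ i, SimpleGraph (V i)) : SimpleGraph W :=
  ⨆ i, (H i).map (f i)

/-- The relation between hubs obtained when the terminals of each piece are related by `π`. -/
def gluedSetoid (hub : κ → ι → P) (π : κ → Setoid ι) : Setoid P :=
  ⨆ i, (π i).map (hub i)

/-- The relation between the terminals of a piece given by reachability within the piece. -/
def terminalSetoid (t : ∀ i, ι → V i) (H : ∀ i, SimpleGraph (V i)) (i : κ) : Setoid ι :=
  (H i).reachableSetoid.comap (t i)

variable {f : ∀ i, V i ↪ W} {t : ∀ i, ι → V i} {h : P ↪ W} {hub : κ → ι → P} {outer : O → P}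
  {H : ∀ i, SimpleGraph (V i)} {π : κ → Setoid ι} {τ : Setoid O}

lemma gluedSetoid_le_iff {s : Setoid P} :
    gluedSetoid hub π ≤ s ↔ ∀ i a b, π i a b → s (hub i a) (hub i b) := by
  simp only [gluedSetoid, iSup_le_iff]
  refine forall_congr' fun i => (Setoid.gi.gc _ s).trans ⟨fun hs a b hab => ?_, ?_⟩
  · exact hs _ _ ⟨a, b, hab, rfl, rfl⟩
  · rintro hs _ _ ⟨a, b, hab, rfl, rfl⟩
    exact hs a b hab

lemma gluedSetoid_rel {i : κ} {a b : ι} (hab : π i a b) :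
    gluedSetoid hub π (hub i a) (hub i b) :=
  gluedSetoid_le_iff.1 le_rfl i a b hab

lemma glue_adj {x y : W} :
    (glue f H).Adj x y ↔ ∃ i u v, (H i).Adj u v ∧ f i u = x ∧ f i v = y := by
  simp only [glue, SimpleGraph.iSup_adj, SimpleGraph.map_adj]

lemma reachable_glue {i : κ} {u v : V i} (huv : (H i).Reachable u v) :
    (glue f H).Reachable (f i u) (f i v) :=
  (huv.map (SimpleGraph.Embedding.map (f i) (H i)).toHom).mono
    (le_iSup (fun i => (H i).map (f i)) i)

/-- The hubs that should be reachable from `w` in the glued graph. -/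
def attachedHubs (f : ∀ i, V i ↪ W) (t : ∀ i, ι → V i) (hub : κ → ι → P)
    (H : ∀ i, SimpleGraph (V i)) (w : W) : Set P :=
  {p | ∃ i u a, f i u = w ∧ (H i).Reachable u (t i a) ∧
    gluedSetoid hub (terminalSetoid t H) (hub i a) p}

namespace IsGluing

variable (hg : IsGluing f t h hub)

include hg

lemma exists_terminal_eq {i j : κ} (hij : i ≠ j) {u : V i} {v : V j} (huv : f i u = f j v) :
    ∃ a b, t i a = u ∧ t j b = v ∧ hub i a = hub j b := by
  obtain ⟨a, rfl⟩ := hg.exists_terminal hij u v huv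
  obtain ⟨b, rfl⟩ := hg.exists_terminal hij.symm v _ huv.symm
  rw [hg.apply_terminal, hg.apply_terminal] at huv
  exact ⟨a, b, rfl, rfl, h.injective huv⟩

lemma mem_attachedHubs_apply {i : κ} {u : V i} {p : P} :
    p ∈ attachedHubs f t hub H (f i u) ↔ ∃ a, (H i).Reachable u (t i a) ∧
      gluedSetoid hub (terminalSetoid t H) (hub i a) p := by
  refine ⟨?_, fun ⟨a, ha⟩ => ⟨i, u, a, rfl, ha⟩⟩
  rintro ⟨j, v, b, hvu, hb, hp⟩
  by_cases hji : j = i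
  · subst hji
    exact ⟨b, (f j).injective hvu ▸ hb, hp⟩
  · obtain ⟨c, a, rfl, rfl, hca⟩ := hg.exists_terminal_eq hji hvu
    exact ⟨a, .rfl, hca ▸ Setoid.trans' _ (gluedSetoid_rel hb) hp⟩

lemma mem_attachedHubs_hub {p q : P} :
    p ∈ attachedHubs f t hub H (h q) ↔ gluedSetoid hub (terminalSetoid t H) q p := by
  obtain ⟨i, a, rfl⟩ := hg.hub_surjective q
  rw [← hg.apply_terminal, hg.mem_attachedHubs_apply]
  exact ⟨fun ⟨b, hab, hp⟩ => Setoid.trans' _ (gluedSetoid_rel hab) hp, fun hp => ⟨a, .rfl, hp⟩⟩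

lemma attachedHubs_eq_of_reachable {x y : W} (hxy : (glue f H).Reachable x y) :
    attachedHubs f t hub H x = attachedHubs f t hub H y := by
  suffices hle : (glue f H).reachableSetoid ≤ Setoid.ker (attachedHubs f t hub H) from hle hxy
  refine reachableSetoid_le_iff.2 fun x y hxy => ?_
  obtain ⟨i, u, v, huv, rfl, rfl⟩ := glue_adj.1 hxy
  ext p
  rw [hg.mem_attachedHubs_apply, hg.mem_attachedHubs_apply]
  exact exists_congr fun a => and_congr_left fun _ =>
    ⟨huv.reachable.symm.trans, huv.reachable.trans⟩

lemma reachable_hub_hub_iff {p q : P} :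
    (glue f H).Reachable (h p) (h q) ↔ gluedSetoid hub (terminalSetoid t H) p q := by
  refine ⟨fun hpq => ?_, fun hpq => ?_⟩
  · rw [← hg.mem_attachedHubs_hub, hg.attachedHubs_eq_of_reachable hpq, hg.mem_attachedHubs_hub]
  · suffices hle : gluedSetoid hub (terminalSetoid t H) ≤ (glue f H).reachableSetoid.comap h from
      hle hpq
    refine gluedSetoid_le_iff.2 fun i a b hab => ?_
    rw [Setoid.comap_rel, ← hg.apply_terminal, ← hg.apply_terminal]
    exact reachable_glue hab

lemma reachable_apply_hub_iff {i : κ} {u : V i} {q : P} :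
    (glue f H).Reachable (f i u) (h q) ↔ ∃ a, (H i).Reachable u (t i a) ∧
      gluedSetoid hub (terminalSetoid t H) (hub i a) q := by
  refine ⟨fun huq => ?_, fun ⟨a, hua, haq⟩ => ?_⟩
  · rw [← hg.mem_attachedHubs_apply, hg.attachedHubs_eq_of_reachable huq, hg.mem_attachedHubs_hub]
  · rw [← hg.reachable_hub_hub_iff, ← hg.apply_terminal] at haq
    exact (reachable_glue hua).trans haq

lemma comap_reachableSetoid_glue :
    (glue f H).reachableSetoid.comap (h ∘ outer)
      = (gluedSetoid hub (terminalSetoid t H)).comap outer :=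
  Setoid.ext fun _ _ => hg.reachable_hub_hub_iff

lemma forall_exists_reachable_glue_iff :
    (∀ w, ∃ o, (glue f H).Reachable w (h (outer o))) ↔
      (∀ i u, ∃ a, (H i).Reachable u (t i a)) ∧
        ∀ p, ∃ o, gluedSetoid hub (terminalSetoid t H) p (outer o) := by
  refine ⟨fun hw => ⟨fun i u => ?_, fun p => ?_⟩, fun ⟨hpiece, hhub⟩ w => ?_⟩
  · obtain ⟨o, ho⟩ := hw (f i u)
    obtain ⟨a, ha, -⟩ := hg.reachable_apply_hub_iff.1 ho
    exact ⟨a, ha⟩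
  · simpa only [hg.reachable_hub_hub_iff] using hw (h p)
  · obtain ⟨i, u, rfl⟩ := hg.exists_eq w
    obtain ⟨a, ha⟩ := hpiece i u
    obtain ⟨o, ho⟩ := hhub (hub i a)
    exact ⟨o, hg.reachable_apply_hub_iff.2 ⟨a, ha, ho⟩⟩

lemma terminal_injective (i : κ) : (t i).Injective := fun a b hab =>
  hg.hub_injective i <| h.injective <| by
    rw [← hg.apply_terminal, ← hg.apply_terminal, hab]

lemma eq_of_apply_eq {i j : κ} (hij : i ≠ j) {u v : V i} {u' v' : V j} (hu : f i u = f j u')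
    (hv : f i v = f j v') : u = v := by
  obtain ⟨a, a', rfl, -, ha⟩ := hg.exists_terminal_eq hij hu
  obtain ⟨b, b', rfl, -, hb⟩ := hg.exists_terminal_eq hij hv
  have hab : hub i a = hub i b :=
    hg.subsingleton_inter hij ⟨⟨a, rfl⟩, a', ha.symm⟩ ⟨⟨b, rfl⟩, b', hb.symm⟩
  rw [hg.hub_injective i hab]

lemma comap_glue (H : ∀ i, SimpleGraph (V i)) (i : κ) : (glue f H).comap (f i) = H i := by
  ext u v
  rw [SimpleGraph.comap_adj, glue_adj]
  refine ⟨fun ⟨j, u', v', huv, hu, hv⟩ => ?_, fun huv => ⟨i, u, v, huv, rfl, rfl⟩⟩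
  by_cases hji : j = i
  · subst hji
    rwa [← (f j).injective hu, ← (f j).injective hv]
  · exact absurd (hg.eq_of_apply_eq hji hu hv) huv.ne

omit hg in
lemma glue_comap {G : ∀ i, SimpleGraph (V i)} {F : SimpleGraph W} (hF : F ≤ glue f G) :
    glue f (fun i => F.comap (f i)) = F := by
  refine le_antisymm (iSup_le fun i => SimpleGraph.map_comap_le (f i) F) fun x y hxy => ?_
  obtain ⟨i, u, v, -, rfl, rfl⟩ := glue_adj.1 (hF hxy)
  exact glue_adj.2 ⟨i, u, v, hxy, rfl, rfl⟩

omit hg in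
lemma glue_mono {G : ∀ i, SimpleGraph (V i)} (hle : ∀ i, H i ≤ G i) : glue f H ≤ glue f G :=
  iSup_mono fun i => SimpleGraph.map_monotone (f i) (hle i)

lemma glue_le_glue_iff {G : ∀ i, SimpleGraph (V i)} :
    glue f H ≤ glue f G ↔ ∀ i, H i ≤ G i := by
  refine ⟨fun hle i => ?_, glue_mono⟩
  rw [← hg.comap_glue H i, ← hg.comap_glue G i]
  exact SimpleGraph.comap_monotone (f i) hle

omit hg in
lemma edgeSet_glue (H : ∀ i, SimpleGraph (V i)) :
    (glue f H).edgeSet = ⋃ i, Sym2.map (f i) '' (H i).edgeSet := by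
  simp only [glue, SimpleGraph.edgeSet_iSup, SimpleGraph.edgeSet_map,
    Function.Embedding.sym2Map_apply]

lemma pairwise_disjoint_edgeSet (H : ∀ i, SimpleGraph (V i)) :
    Pairwise (Function.onFun Disjoint fun i => Sym2.map (f i) '' (H i).edgeSet) := by
  refine fun i j hij => Set.disjoint_left.2 ?_
  rintro _ ⟨⟨u, v⟩, huv, rfl⟩ ⟨⟨u', v'⟩, -, he⟩
  rcases Sym2.eq_iff.1 he with ⟨hu, hv⟩ | ⟨hv, hu⟩
  all_goals exact huv.ne (hg.eq_of_apply_eq hij hu.symm hv.symm)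

lemma weight_glue {K : Type*} [CommRing K] [Fintype κ] [Fintype W] [∀ i, Fintype (V i)]
    (w : Sym2 W → K) (H : ∀ i, SimpleGraph (V i)) :
    weight w (glue f H) = ∏ i, weight (w ∘ Sym2.map (f i)) (H i) := by
  simp only [weight_eq_finprod, edgeSet_glue]
  rw [finprod_mem_iUnion (hg.pairwise_disjoint_edgeSet H) fun i => Set.toFinite _,
    finprod_eq_prod_of_fintype]
  exact Finset.prod_congr rfl fun i _ =>
    finprod_mem_image (Sym2.map.injective (f i).injective).injOn

lemma ncard_edgeSet_glue [Fintype κ] [∀ i, Finite (V i)] (H : ∀ i, SimpleGraph (V i)) :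
    (glue f H).edgeSet.ncard = ∑ i, (H i).edgeSet.ncard := by
  rw [edgeSet_glue, Set.ncard_iUnion_of_finite (fun i => Set.toFinite _)
    (hg.pairwise_disjoint_edgeSet H), finsum_eq_sum_of_fintype]
  exact Finset.sum_congr rfl fun i _ =>
    Set.ncard_image_of_injective _ (Sym2.map.injective (f i).injective)

lemma card_add_card_mul_card [Fintype κ] [∀ i, Finite (V i)] [Finite P] :
    Nat.card W + Nat.card κ * Nat.card ι = Nat.card P + ∑ i, Nat.card (V i) := by
  let g : P ⊕ (Σ i, ↥(Set.range (t i))ᶜ) → W := Sum.elim h fun x => f x.1 x.2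
  have hg_injective : g.Injective := by
    refine Function.Injective.sumElim h.injective ?_ ?_
    · rintro ⟨i, u, hu⟩ ⟨j, v, hv⟩ huv
      by_cases hij : i = j
      · subst hij
        obtain rfl := (f i).injective huv
        rfl
      · exact absurd (hg.exists_terminal hij u v huv) hu
    · rintro p ⟨i, u, hu⟩ hpu
      obtain ⟨j, a, rfl⟩ := hg.hub_surjective p
      rw [← hg.apply_terminal] at hpu
      by_cases hij : i = j
      · subst hij
        exact hu ⟨a, (f i).injective hpu⟩
      · exact hu (hg.exists_terminal hij u _ hpu.symm)
  have hg_surjective : g.Surjective := fun w => by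
    obtain ⟨i, u, rfl⟩ := hg.exists_eq w
    by_cases hu : u ∈ Set.range (t i)
    · obtain ⟨a, rfl⟩ := hu
      exact ⟨.inl (hub i a), (hg.apply_terminal i a).symm⟩
    · exact ⟨.inr ⟨i, u, hu⟩, rfl⟩
  have h_piece (i : κ) : Nat.card ↥(Set.range (t i))ᶜ + Nat.card ι = Nat.card (V i) := by
    rw [Nat.card_coe_set_eq, ← Set.ncard_range_of_injective (hg.terminal_injective i), add_comm,
      Set.ncard_add_ncard_compl]
  rw [← Nat.card_congr (Equiv.ofBijective g ⟨hg_injective, hg_surjective⟩), Nat.card_sum,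
    Nat.card_sigma, add_assoc]
  simp only [← h_piece, Finset.sum_add_distrib, Finset.sum_const, Finset.card_univ, smul_eq_mul,
    Nat.card_eq_fintype_card]

end IsGluing

/-- Gluing pieces whose terminals are connected according to `π` connects every hub to an outer
hub, connects the outer hubs according to `τ`, and creates no cycle. The absence of cycles is the
Euler characteristic condition `card_eq`. -/
structure Combines [Fintype κ] (hub : κ → ι → P) (outer : O → P) (π : κ → Setoid ι)
    (τ : Setoid O) : Prop where
  exists_rel : ∀ p, ∃ o, gluedSetoid hub π p (outer o)
  comap_eq : (gluedSetoid hub π).comap outer = τ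
  card_eq : Nat.card (Quotient (gluedSetoid hub π)) + Nat.card κ * Nat.card ι
    = Nat.card P + ∑ i, Nat.card (Quotient (π i))

namespace IsGluing

variable [Fintype κ] [Finite P] {G : ∀ i, SimpleGraph (V i)}

lemma isAcyclic_glue_iff [Finite W] [∀ i, Finite (V i)] (hg : IsGluing f t h hub)
    (h_acyclic : ∀ i, (H i).IsAcyclic)
    (h_piece : ∀ i u, ∃ a, (H i).Reachable u (t i a))
    (h_hub : ∀ p, ∃ o, gluedSetoid hub (terminalSetoid t H) p (outer o)) :
    (glue f H).IsAcyclic ↔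
      Nat.card (Quotient (gluedSetoid hub (terminalSetoid t H))) + Nat.card κ * Nat.card ι
        = Nat.card P + ∑ i, Nat.card (Quotient (terminalSetoid t H i)) := by
  have h_components : Nat.card (glue f H).ConnectedComponent
      = Nat.card (Quotient (gluedSetoid hub (terminalSetoid t H))) := by
    rw [← card_quotient_comap_eq_iff.2 h_hub, ← hg.comap_reachableSetoid_glue]
    exact card_connectedComponent_eq_iff.2
      (hg.forall_exists_reachable_glue_iff.2 ⟨h_piece, h_hub⟩)
  have h_pieces : ∑ i, (H i).edgeSet.ncard + ∑ i, Nat.card (Quotient (terminalSetoid t H i))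
      = ∑ i, Nat.card (V i) := by
    rw [← Finset.sum_add_distrib]
    refine Finset.sum_congr rfl fun i _ => ?_
    rw [← isAcyclic_iff_ncard_edgeSet_add_card_connectedComponent.1 (h_acyclic i),
      card_connectedComponent_eq_iff.2 (h_piece i)]
    rfl
  rw [isAcyclic_iff_ncard_edgeSet_add_card_connectedComponent, h_components,
    hg.ncard_edgeSet_glue]
  have := hg.card_add_card_mul_card
  omega

lemma isRootedForest_glue_iff [Finite W] [∀ i, Finite (V i)] (hg : IsGluing f t h hub) :
    IsRootedForest (glue f G) (h ∘ outer) τ (glue f H) ↔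
      (∀ i, IsRootedForest (G i) (t i) (terminalSetoid t H i) (H i)) ∧
        Combines hub outer (terminalSetoid t H) τ := by
  constructor
  · rintro ⟨hle, h_acyclic, h_rooted, h_comap⟩
    obtain ⟨h_piece, h_hub⟩ := hg.forall_exists_reachable_glue_iff.1 h_rooted
    have h_acyclic_piece (i : κ) : (H i).IsAcyclic := by
      rw [← hg.comap_glue H i]
      exact h_acyclic.of_comap (f i)
    exact ⟨fun i => ⟨hg.glue_le_glue_iff.1 hle i, h_acyclic_piece i, h_piece i, rfl⟩,
      h_hub, hg.comap_reachableSetoid_glue.symm.trans h_comap,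
      (hg.isAcyclic_glue_iff h_acyclic_piece h_piece h_hub).1 h_acyclic⟩
  · rintro ⟨hH, h_hub, h_comap, h_card⟩
    have h_piece (i : κ) := (hH i).exists_reachable
    exact ⟨hg.glue_le_glue_iff.2 fun i => (hH i).le,
      (hg.isAcyclic_glue_iff (fun i => (hH i).isAcyclic) h_piece h_hub).2 h_card,
      hg.forall_exists_reachable_glue_iff.2 ⟨h_piece, h_hub⟩,
      hg.comap_reachableSetoid_glue.trans h_comap⟩

end IsGluing

instance finite_setoid {α : Type*} [Finite α] : Finite (Setoid α) :=
  Finite.of_injective (fun s : Setoid α => fun x y => s x y) fun _ _ h =>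
    Setoid.ext fun x y => iff_of_eq (congrFun₂ h x y)

noncomputable instance fintype_setoid {α : Type*} [Finite α] : Fintype (Setoid α) :=
  Fintype.ofFinite _

open Classical in
theorem IsGluing.rootedGF_glue {K : Type*} [CommRing K] [Fintype κ] [DecidableEq κ] [Finite ι]
    [Finite P] [Fintype W] [∀ i, Fintype (V i)] (hg : IsGluing f t h hub)
    (G : ∀ i, SimpleGraph (V i)) (w : Sym2 W → K) :
    rootedGF (glue f G) (h ∘ outer) w τ = ∑ π : κ → Setoid ι with Combines hub outer π τ,
      ∏ i, rootedGF (G i) (t i) (w ∘ Sym2.map (f i)) (π i) := by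
  calc rootedGF (glue f G) (h ∘ outer) w τ
    _ = ∑ H : ∀ i, SimpleGraph (V i) with
          (∀ i, IsRootedForest (G i) (t i) (terminalSetoid t H i) (H i)) ∧
            Combines hub outer (terminalSetoid t H) τ,
          ∏ i, weight (w ∘ Sym2.map (f i)) (H i) := by
      refine Finset.sum_bij' (fun F _ i => F.comap (f i)) (fun H _ => glue f H) ?_ ?_ ?_ ?_ ?_
      all_goals simp only [Finset.mem_filter_univ]
      · intro F hF
        rwa [← hg.isRootedForest_glue_iff, glue_comap hF.le]
      · exact fun H hH => hg.isRootedForest_glue_iff.2 hH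
      · exact fun F hF => glue_comap hF.le
      · exact fun H _ => funext (hg.comap_glue H)
      · intro F hF
        rw [← hg.weight_glue, glue_comap hF.le]
    _ = ∑ π : κ → Setoid ι with Combines hub outer π τ,
          ∑ H ∈ Fintype.piFinset fun i => Finset.univ.filter (IsRootedForest (G i) (t i) (π i)),
            ∏ i, weight (w ∘ Sym2.map (f i)) (H i) := by
      rw [← Finset.sum_fiberwise_of_maps_to (g := terminalSetoid t)]
      · refine Finset.sum_congr rfl fun π hπ => Finset.sum_congr ?_ fun _ _ => rfl
        ext H
        simp only [Finset.mem_filter, Finset.mem_univ, true_and, Fintype.mem_piFinset] at hπ ⊢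
        constructor
        · rintro ⟨⟨hH, -⟩, rfl⟩
          exact hH
        · intro hH
          obtain rfl : terminalSetoid t H = π := funext fun i => (hH i).comap_reachable
          exact ⟨⟨hH, hπ⟩, rfl⟩
      · exact fun H hH => Finset.mem_filter_univ _ |>.2 (Finset.mem_filter_univ _ |>.1 hH).2
    _ = _ := by
      simp only [rootedGF, genFun, Finset.prod_univ_sum]

end Gluing

section Decision

variable {ι P W O X : Type*} {n : ℕ} {V : Fin n → Type*} {hub : Fin n → ι → P} {outer : O → P}

/-- The pairs of hubs that get connected when the pairs `l i` of terminals of the `i`-th piece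
are connected. -/
def gluedPairs (hub : Fin n → ι → P) (l : Fin n → List (ι × ι)) : List (P × P) :=
  (List.finRange n).flatMap fun i => (l i).map (Prod.map (hub i) (hub i))

lemma gluedSetoid_pairSetoid (hub : Fin n → ι → P) (l : Fin n → List (ι × ι)) :
    gluedSetoid hub (fun i => pairSetoid (l i)) = pairSetoid (gluedPairs hub l) := by
  refine eq_of_forall_ge_iff fun s => ?_
  have h_piece (i : Fin n) : (∀ a b, pairSetoid (l i) a b → s (hub i a) (hub i b))
      ↔ ∀ a b, (a, b) ∈ l i → s (hub i a) (hub i b) :=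
    pairSetoid_le_iff (s := s.comap (hub i))
  simp only [gluedSetoid_le_iff, h_piece, pairSetoid_le_iff, gluedPairs, List.mem_flatMap,
    List.mem_finRange, true_and, List.mem_map, Prod.exists, Prod.map_apply, Prod.mk.injEq]
  refine ⟨?_, fun hs i a b hab => hs _ _ ⟨i, a, b, hab, rfl, rfl⟩⟩
  rintro hs _ _ ⟨i, a, b, hab, rfl, rfl⟩
  exact hs i a b hab

lemma combines_pairSetoid_iff [Fintype ι] [DecidableEq ι] [Fintype P] [DecidableEq P]
    {l : Fin n → List (ι × ι)} {m : List (O × O)} :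
    Combines hub outer (fun i => pairSetoid (l i)) (pairSetoid m) ↔
      (∀ p, ∃ o, pairSetoid (gluedPairs hub l) p (outer o)) ∧
      (∀ a b, pairSetoid (gluedPairs hub l) (outer a) (outer b) ↔ pairSetoid m a b) ∧
      (Finset.univ.image (pairLabel (gluedPairs hub l))).card + n * Fintype.card ι
        = Fintype.card P + ∑ i, (Finset.univ.image (pairLabel (l i))).card := by
  simp only [← card_quotient_pairSetoid, ← Nat.card_eq_fintype_card]
  rw [← gluedSetoid_pairSetoid]
  constructor
  · rintro ⟨h_rel, h_comap, h_euler⟩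
    exact ⟨h_rel, Setoid.ext_iff.1 h_comap, by rwa [Nat.card_fin] at h_euler⟩
  · rintro ⟨h_rel, h_comap, h_euler⟩
    exact ⟨h_rel, Setoid.ext h_comap, by rwa [Nat.card_fin]⟩

instance [Fintype ι] [DecidableEq ι] [Fintype P] [DecidableEq P] [Fintype O] [DecidableEq O]
    (l : Fin n → List (ι × ι)) (m : List (O × O)) :
    Decidable (Combines hub outer (fun i => pairSetoid (l i)) (pairSetoid m)) :=
  decidable_of_iff' _ combines_pairSetoid_iff

lemma bijective_pairSetoid {p : X → List (ι × ι)}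
    (h_inj : ∀ x y, (∀ a b, pairSetoid (p x) a b ↔ pairSetoid (p y) a b) → x = y)
    (h_surj : ∀ r : ι → ι, ∃ x, ∀ a b, pairSetoid (p x) a b ↔ r a = r b) :
    Function.Bijective fun x => pairSetoid (p x) := by
  refine ⟨fun x y hxy => h_inj x y (Setoid.ext_iff.1 hxy), fun s => ?_⟩
  obtain ⟨x, hx⟩ := h_surj fun a => Quotient.out (Quotient.mk s a)
  refine ⟨x, Setoid.ext fun a b => (hx a b).trans ?_⟩
  rw [Quotient.out_inj, Quotient.eq]

theorem IsGluing.rootedGF_glue_pairSetoid {K : Type*} [CommRing K] [Fintype ι] [DecidableEq ι]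
    [Fintype P] [DecidableEq P] [Fintype O] [DecidableEq O] [Fintype X] [Fintype W]
    [∀ i, Fintype (V i)] {f : ∀ i, V i ↪ W} {t : ∀ i, ι → V i} {h : P ↪ W}
    (hg : IsGluing f t h hub) (G : ∀ i, SimpleGraph (V i)) (w : Sym2 W → K)
    {p : X → List (ι × ι)} (hp : Function.Bijective fun x => pairSetoid (p x))
    (m : List (O × O)) :
    rootedGF (glue f G) (h ∘ outer) w (pairSetoid m) =
      ∑ x : Fin n → X with Combines hub outer (fun i => pairSetoid (p (x i))) (pairSetoid m),
        ∏ i, rootedGF (G i) (t i) (w ∘ Sym2.map (f i)) (pairSetoid (p (x i))) := by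
  classical
  rw [hg.rootedGF_glue]
  refine (Finset.sum_equiv (Equiv.piCongrRight fun _ => Equiv.ofBijective _ hp)
    (fun x => ?_) fun x _ => rfl).symm
  simp only [Finset.mem_filter_univ]
  rfl

end Decision

/-- The partitions of the three corners of a triangle: all corners together, corner `i` separated
from the other two, or three separate corners. -/
inductive Pattern
  | joined
  | alone (i : Fin 3)
  | discrete
  deriving DecidableEq, Fintype

namespace Pattern

/-- Pairs of corners that generate the partition. -/
def pairs : Pattern → List (Fin 3 × Fin 3)
  | joined => [(0, 1), (0, 2)]
  | alone i => [(i + 1, i + 2)]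
  | discrete => []

/-- The partition as an equivalence relation. -/
abbrev setoid (p : Pattern) : Setoid (Fin 3) :=
  pairSetoid p.pairs

lemma bijective_setoid : Function.Bijective setoid :=
  bijective_pairSetoid (by decide +kernel) (by decide +kernel)

lemma eq_setoid_iff {s : Setoid (Fin 3)} {q : Pattern} {φ : Setoid (Fin 3) → Prop}
    (hφ : ∀ p : Pattern, p = q ↔ φ p.setoid) : s = q.setoid ↔ φ s := by
  obtain ⟨p, rfl⟩ := bijective_setoid.2 s
  rw [bijective_setoid.1.eq_iff, hφ]

lemma setoid_joined : joined.setoid = ⊤ :=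
  eq_top_iff.2 fun a b _ => (by decide : ∀ a b, joined.setoid a b) a b

end Pattern

section Triangle

open Pattern

/-- The gluing scheme of the Sierpiński graphs: corner `j` of the piece in corner `i` of the large
triangle becomes the midpoint `s(i, j)` of the corners `i` and `j`, which is corner `i` for
`j = i`. -/
def midpointHub (i j : Fin 3) : Sym2 (Fin 3) :=
  s(i, j)

/-- The hubs that are corners of the large triangle. -/
def cornerHub (i : Fin 3) : Sym2 (Fin 3) :=
  s(i, i)

/-- The multisets of the patterns of the three pieces, over all ways in which three pieces combine
to a forest of pattern `q`. -/
def combinations (q : Pattern) : Multiset (Multiset Pattern) :=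
  (Finset.univ.filter fun x : Fin 3 → Pattern =>
    Combines midpointHub cornerHub (fun i => (x i).setoid) q.setoid).val.map
      fun x => Finset.univ.val.map x

lemma combinations_joined : combinations joined = 2 • ∑ j, {{joined, joined, alone j}} := by
  decide +kernel

lemma combinations_alone (i : Fin 3) :
    combinations (alone i) = 2 • ∑ j, {{joined, alone i, alone j}}
      + {{joined, alone i, alone i}} + {{joined, joined, discrete}} := by
  revert i
  decide +kernel

lemma combinations_discrete :
    combinations discrete = 4 • ∑ j, {{joined, discrete, alone j}}
      + 2 • ∑ j, ({{alone j, alone j, alone (j + 1)}} + {{alone j, alone j, alone (j + 2)}})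
      + 2 • {{alone 0, alone 1, alone 2}} := by
  decide +kernel

variable {K W : Type*} [CommRing K] [Fintype W] {V : Fin 3 → Type*} [∀ i, Fintype (V i)]
  {f : ∀ i, V i ↪ W} {t : ∀ i, Fin 3 → V i} {h : Sym2 (Fin 3) ↪ W}

theorem IsGluing.rootedGF_glue_eq_sum_combinations (hg : IsGluing f t h midpointHub)
    (G : ∀ i, SimpleGraph (V i)) (w : Sym2 W → K) {F : Pattern → K}
    (hF : ∀ i p, rootedGF (G i) (t i) (w ∘ Sym2.map (f i)) p.setoid = F p) (q : Pattern) :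
    rootedGF (glue f G) (h ∘ cornerHub) w q.setoid
      = ((combinations q).map fun m => (m.map F).prod).sum := by
  rw [hg.rootedGF_glue_pairSetoid G w bijective_setoid, combinations, Multiset.map_map]
  refine Finset.sum_congr rfl fun x _ => ?_
  rw [Function.comp_apply, Multiset.map_map]
  exact Finset.prod_congr rfl fun i _ => hF i (x i)

end Triangle

section BaseTriangle

open Pattern

/-- The gluing scheme of a triangle from its three sides: side `i` is opposite to corner `i`. -/
def sideHub (i : Fin 3) (j : Fin 2) : Fin 3 :=
  i.succAbove j

/-- Pairs of end points generating the two partitions of the end points of an edge: together or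
separate. -/
def sidePairs : Bool → List (Fin 2 × Fin 2)
  | true => [(0, 1)]
  | false => []

lemma bijective_pairSetoid_sidePairs : Function.Bijective fun x => pairSetoid (sidePairs x) :=
  bijective_pairSetoid (by decide) (by decide)

lemma combines_sideHub_joined_iff : ∀ x : Fin 3 → Bool,
    Combines sideHub id (fun i => pairSetoid (sidePairs (x i))) joined.setoid
      ↔ ∃ i, x = fun j => decide (j ≠ i) := by
  decide +kernel

lemma combines_sideHub_alone_iff : ∀ (i : Fin 3) (x : Fin 3 → Bool),
    Combines sideHub id (fun i => pairSetoid (sidePairs (x i))) (alone i).setoid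
      ↔ x = fun j => decide (j = i) := by
  decide +kernel

lemma combines_sideHub_discrete_iff : ∀ x : Fin 3 → Bool,
    Combines sideHub id (fun i => pairSetoid (sidePairs (x i))) discrete.setoid
      ↔ x = fun _ => false := by
  decide +kernel

lemma isGluing_sideHub {W : Type*} (e : Fin 3 ≃ W) :
    IsGluing (fun i => (Fin.succAboveEmb i).trans e.toEmbedding) (fun _ => id) e.toEmbedding
      sideHub where
  exists_eq w := by
    obtain ⟨i, j, hij⟩ : ∃ i j, sideHub i j = e.symm w := by
      generalize e.symm w = p
      revert p
      decide
    exact ⟨i, j, e.symm_apply_eq.1 hij.symm |>.symm⟩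
  apply_terminal _ _ := rfl
  exists_terminal _ u _ _ := ⟨u, rfl⟩
  hub_injective i := Fin.succAbove_right_injective
  hub_surjective := by decide
  subsingleton_inter {i j} hij := by
    rintro _ ⟨⟨a, rfl⟩, a', ha⟩ _ ⟨⟨b, rfl⟩, b', hb⟩
    revert i j a a' b b'
    decide

lemma glue_top_eq_top {W : Type*} (e : Fin 3 ≃ W) :
    glue (fun i => (Fin.succAboveEmb i).trans e.toEmbedding) (fun _ => ⊤) = ⊤ := by
  ext x y
  obtain ⟨p, rfl⟩ := e.surjective x
  obtain ⟨q, rfl⟩ := e.surjective y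
  have h_sides : (∃ i u v, u ≠ v ∧ sideHub i u = p ∧ sideHub i v = q) ↔ p ≠ q := by
    revert p q
    decide
  simpa [glue_adj, sideHub] using h_sides

lemma reachableSetoid_edge (x : Bool) :
    (if x then ⊤ else ⊥ : SimpleGraph (Fin 2)).reachableSetoid = pairSetoid (sidePairs x) := by
  refine eq_of_forall_ge_iff fun s => ?_
  rw [reachableSetoid_le_iff, pairSetoid_le_iff]
  cases x
  · simp [sidePairs]
  · simp [sidePairs, Fin.forall_fin_two, s.comm']

lemma isRootedForest_edge_iff {x : Bool} {H : SimpleGraph (Fin 2)} :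
    IsRootedForest ⊤ id (pairSetoid (sidePairs x)) H ↔ H = if x then ⊤ else ⊥ := by
  constructor
  · intro hH
    obtain ⟨y, rfl⟩ : ∃ y : Bool, H = if y then ⊤ else ⊥ := by
      classical
      refine ⟨decide (H.Adj 0 1), SimpleGraph.ext (funext₂ fun u v => ?_)⟩
      by_cases h_adj : H.Adj 0 1 <;> fin_cases u <;> fin_cases v <;>
        simp [h_adj, H.adj_comm 1 0]
    have hyx := hH.comap_reachable
    rw [reachableSetoid_edge] at hyx
    rw [bijective_pairSetoid_sidePairs.1 hyx]
  · rintro rfl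
    exact ⟨le_top, .of_card_le_two (by simp), fun v => ⟨v, .rfl⟩, reachableSetoid_edge x⟩

lemma rootedGF_edge {K : Type*} [CommRing K] (w : Sym2 (Fin 2) → K) (x : Bool) :
    rootedGF ⊤ id w (pairSetoid (sidePairs x)) = if x then w s(0, 1) else 1 := by
  have h_edges : (⊤ : SimpleGraph (Fin 2)).edgeSet = {s(0, 1)} := by
    ext e
    induction e with | _ u v
    fin_cases u <;> fin_cases v <;> simp
  rw [rootedGF, genFun_eq_weight fun _ => isRootedForest_edge_iff, weight_eq_finprod]
  cases x
  · simp
  · simp [h_edges]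

lemma rootedGF_triangle {K W : Type*} [CommRing K] [Fintype W] (e : Fin 3 ≃ W) (w : Sym2 W → K)
    (q : Pattern) : rootedGF ⊤ e w q.setoid =
      ∑ x : Fin 3 → Bool with
          Combines sideHub id (fun i => pairSetoid (sidePairs (x i))) q.setoid,
        ∏ i, if x i then w s(e (i.succAbove 0), e (i.succAbove 1)) else 1 := by
  have h_glue := (isGluing_sideHub e).rootedGF_glue_pairSetoid (outer := id) (fun _ => ⊤) w
    bijective_pairSetoid_sidePairs q.pairs
  rw [glue_top_eq_top] at h_glue
  refine h_glue.trans ?_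
  simp only [rootedGF_edge]
  rfl

lemma rootedGF_triangle_joined {K W : Type*} [CommRing K] [Fintype W] (e : Fin 3 ≃ W)
    (w : Sym2 W → K) : rootedGF ⊤ e w joined.setoid =
      ∑ i, ∏ j : Fin 3 with j ≠ i, w s(e (j.succAbove 0), e (j.succAbove 1)) := by
  have h_filter : (Finset.univ.filter fun x : Fin 3 → Bool => ∃ i, x = fun j => decide (j ≠ i))
      = Finset.univ.image fun i j => decide (j ≠ i) := by
    ext x
    simp [eq_comm]
  have h_inj : Function.Injective fun i j : Fin 3 => decide (j ≠ i) := by decide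
  simp only [rootedGF_triangle, combines_sideHub_joined_iff, h_filter, Finset.sum_image h_inj.injOn,
    Finset.prod_filter, decide_eq_true_eq]

lemma rootedGF_triangle_alone {K W : Type*} [CommRing K] [Fintype W] (e : Fin 3 ≃ W)
    (w : Sym2 W → K) (i : Fin 3) : rootedGF ⊤ e w (alone i).setoid =
      w s(e (i.succAbove 0), e (i.succAbove 1)) := by
  simp only [rootedGF_triangle, combines_sideHub_alone_iff, Finset.sum_filter, Finset.sum_ite_eq']
  simp

lemma rootedGF_triangle_discrete {K W : Type*} [CommRing K] [Fintype W] (e : Fin 3 ≃ W)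
    (w : Sym2 W → K) : rootedGF ⊤ e w discrete.setoid = 1 := by
  simp [rootedGF_triangle, combines_sideHub_discrete_iff, Finset.sum_filter]

end BaseTriangle

end SpanningGF

namespace Sierpinski

open SpanningGF Pattern

/-- The corners of the Sierpiński graph of side `2 ^ k` in the order left, right, up. They are also
the translations that carry the smaller graph to its copies in the graph of doubled side. -/
def cornerPoint (k : ℕ) (i : Fin 3) : ℕ × ℕ :=
  ![(0, 0), (2 ^ k, 0), (0, 2 ^ k)] i

lemma cornerPoint_eq_smul (k : ℕ) (i : Fin 3) : cornerPoint k i = 2 ^ k • cornerPoint 0 i := by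
  fin_cases i <;> simp [cornerPoint]

lemma cornerPoint_succ (k : ℕ) (i : Fin 3) :
    cornerPoint (k + 1) i = cornerPoint k i + cornerPoint k i := by
  rw [cornerPoint_eq_smul, cornerPoint_eq_smul k, ← add_smul, pow_succ, mul_two]

lemma mem_vertices_succ {k : ℕ} {p : ℕ × ℕ} :
    p ∈ vertices (k + 1) ↔ ∃ i, ∃ q ∈ vertices k, q + cornerPoint k i = p := by
  simp [vertices, cornerPoint, Fin.exists_fin_succ, Prod.mk_zero_zero, -Prod.exists]

lemma mem_edges_succ {k : ℕ} {e : Sym2 (ℕ × ℕ)} :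
    e ∈ edges (k + 1) ↔ ∃ i, ∃ d ∈ edges k, d.map (· + cornerPoint k i) = e := by
  simp [edges, cornerPoint, Fin.exists_fin_succ, Prod.mk_zero_zero]

lemma add_le_of_mem_vertices {k : ℕ} {p : ℕ × ℕ} (hp : p ∈ vertices k) : p.1 + p.2 ≤ 2 ^ k := by
  induction k generalizing p with
  | zero => revert p; decide
  | succ k ih =>
    obtain ⟨i, q, hq, rfl⟩ := mem_vertices_succ.1 hp
    have hq_le := ih hq
    rw [pow_succ]
    fin_cases i <;> dsimp only [cornerPoint, Prod.fst_add, Prod.snd_add, Fin.zero_eta, Fin.mk_one,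
      Fin.reduceFinMk, Matrix.cons_val] <;> omega

/-- The three corners in the order left, right, up. -/
def corners (k : ℕ) : Fin 3 → vertices k :=
  ![left k, right k, up k]

lemma coe_corners (k : ℕ) (i : Fin 3) : (corners k i : ℕ × ℕ) = cornerPoint k i := by
  fin_cases i <;> simp [corners, cornerPoint, left, right, up]

/-- The embedding of the Sierpiński graph as the copy in corner `i` of the next one. -/
def copy (k : ℕ) (i : Fin 3) : vertices k ↪ vertices (k + 1) where
  toFun q := ⟨q + cornerPoint k i, mem_vertices_succ.2 ⟨i, q, q.2, rfl⟩⟩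
  inj' _ _ h := Subtype.ext (add_right_cancel (Subtype.ext_iff.1 h))

lemma coe_copy (k : ℕ) (i : Fin 3) (q : vertices k) :
    (copy k i q : ℕ × ℕ) = q + cornerPoint k i :=
  rfl

lemma coe_copy_corners (k : ℕ) (i j : Fin 3) :
    (copy k i (corners k j) : ℕ × ℕ) = cornerPoint k j + cornerPoint k i := by
  rw [coe_copy, coe_corners]

lemma mk_eq_of_cornerPoint_add_eq {k : ℕ} {i j i' j' : Fin 3}
    (h : cornerPoint k i + cornerPoint k j = cornerPoint k i' + cornerPoint k j') :
    s(i, j) = s(i', j') := by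
  simp only [cornerPoint_eq_smul k, ← smul_add] at h
  have h_unit := smul_right_injective (ℕ × ℕ) (pow_ne_zero k two_ne_zero) h
  clear h
  revert i j i' j'
  decide

/-- The common corners of the three copies: the corners of the large triangle and the midpoints of
its sides. -/
def hubs (k : ℕ) : Sym2 (Fin 3) ↪ vertices (k + 1) where
  toFun := Sym2.lift ⟨fun i j => copy k i (corners k j), fun i j => Subtype.ext <| by
    rw [coe_copy_corners, coe_copy_corners, add_comm]⟩
  inj' := by
    refine Sym2.ind fun i j => Sym2.ind fun i' j' h => ?_
    have h_coe := Subtype.ext_iff.1 h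
    simp only [Sym2.lift_mk, coe_copy_corners] at h_coe
    rw [Sym2.eq_swap, mk_eq_of_cornerPoint_add_eq h_coe, Sym2.eq_swap]

lemma hubs_mk (k : ℕ) (i j : Fin 3) : hubs k s(i, j) = copy k i (corners k j) :=
  rfl

lemma corners_succ (k : ℕ) : corners (k + 1) = hubs k ∘ cornerHub := by
  funext i
  refine Subtype.ext ?_
  rw [Function.comp_apply, cornerHub, hubs_mk, coe_copy_corners, coe_corners, cornerPoint_succ]

lemma eq_corners_of_copy_eq_copy {k : ℕ} {i j : Fin 3} (hij : i ≠ j) {u v : vertices k}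
    (huv : copy k i u = copy k j v) : u = corners k j := by
  have hu := add_le_of_mem_vertices u.2
  have hv := add_le_of_mem_vertices v.2
  have h_coe := Subtype.ext_iff.1 huv
  refine Subtype.ext ?_
  rw [coe_corners]
  simp only [coe_copy, cornerPoint, Prod.ext_iff] at h_coe ⊢
  fin_cases i <;> fin_cases j <;> first
    | exact absurd rfl hij
    | dsimp only [Prod.fst_add, Prod.snd_add, Fin.zero_eta, Fin.mk_one, Fin.reduceFinMk,
        Matrix.cons_val] at h_coe ⊢
      omega

lemma isGluing_copy (k : ℕ) :
    IsGluing (copy k) (fun _ => corners k) (hubs k) midpointHub where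
  exists_eq w := by
    obtain ⟨i, q, hq, hw⟩ := mem_vertices_succ.1 w.2
    exact ⟨i, ⟨q, hq⟩, Subtype.ext hw⟩
  apply_terminal _ _ := rfl
  exists_terminal hij _ _ huv := ⟨_, (eq_corners_of_copy_eq_copy hij huv).symm⟩
  hub_injective := by decide
  hub_surjective := by decide
  subsingleton_inter {i j} hij := by
    rintro _ ⟨⟨a, rfl⟩, a', ha⟩ _ ⟨⟨b, rfl⟩, b', hb⟩
    revert i j a a' b b'
    decide

lemma gasket_adj {k : ℕ} {u v : vertices k} :
    (gasket k).Adj u v ↔ s((u : ℕ × ℕ), (v : ℕ × ℕ)) ∈ edges k ∧ u ≠ v := by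
  rw [gasket, SimpleGraph.comap_adj, SimpleGraph.fromEdgeSet_adj, Finset.mem_coe,
    Subtype.coe_ne_coe]

lemma gasket_succ (k : ℕ) : gasket (k + 1) = glue (copy k) fun _ => gasket k := by
  ext x y
  rw [gasket_adj, glue_adj, mem_edges_succ]
  constructor
  · rintro ⟨⟨i, d, hd, hxy⟩, hne⟩
    obtain ⟨p, q, hpq, hx, hy⟩ : ∃ p q, s(p, q) ∈ edges k ∧ p + cornerPoint k i = x
        ∧ q + cornerPoint k i = y := by
      induction d with | _ p q
      obtain ⟨hx, hy⟩ | ⟨hy, hx⟩ := Sym2.eq_iff.1 hxy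
      exacts [⟨p, q, hd, hx, hy⟩, ⟨q, p, Sym2.eq_swap ▸ hd, hx, hy⟩]
    have hp := mem_vertices_of_mem_edges k _ hpq p (Sym2.mem_mk_left p q)
    have hq := mem_vertices_of_mem_edges k _ hpq q (Sym2.mem_mk_right p q)
    obtain rfl : copy k i ⟨p, hp⟩ = x := Subtype.ext hx
    obtain rfl : copy k i ⟨q, hq⟩ = y := Subtype.ext hy
    exact ⟨i, _, _, gasket_adj.2 ⟨hpq, fun h => hne (congrArg _ h)⟩, rfl, rfl⟩
  · rintro ⟨i, u, v, huv, rfl, rfl⟩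
    rw [gasket_adj] at huv
    exact ⟨⟨i, _, huv.1, rfl⟩, (copy k i).injective.ne huv.2⟩

lemma dirLabel_comp_map_copy {K : Type*} (a b c : K) (k : ℕ) (i : Fin 3) :
    dirLabel a b c (k + 1) ∘ Sym2.map (copy k i) = dirLabel a b c k := by
  refine funext (Sym2.ind fun u v => ?_)
  simp [dirLabel, label, coe_copy]

/-- The three corners as all the vertices of the elementary triangle. -/
noncomputable def cornersEquiv : Fin 3 ≃ vertices 0 :=
  .ofBijective (corners 0) (by decide +kernel)

lemma gasket_zero : gasket 0 = ⊤ := by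
  ext x y
  rw [gasket_adj, SimpleGraph.top_adj]
  revert x y
  decide +kernel

lemma dirLabel_cornersEquiv {K : Type*} (a b c : K) (i : Fin 3) :
    dirLabel a b c 0 s(cornersEquiv (i.succAbove 0), cornersEquiv (i.succAbove 1))
      = ![c, a, b] i := by
  fin_cases i <;> rfl

section CornerForests

variable {K : Type*} [CommRing K] (a b c : K) (k : ℕ)

/-- The weighted generating function of the spanning forests in which every component contains a
corner, and which induce the partition `p` of the corners. -/
noncomputable def cornerGF (p : Pattern) : K :=
  rootedGF (gasket k) (corners k) (dirLabel a b c k) p.setoid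

lemma cornerGF_succ (q : Pattern) : cornerGF a b c (k + 1) q
    = ((combinations q).map fun m => (m.map (cornerGF a b c k)).prod).sum := by
  rw [cornerGF, corners_succ, gasket_succ]
  refine (isGluing_copy k).rootedGF_glue_eq_sum_combinations _ _ (fun i p => ?_) q
  rw [dirLabel_comp_map_copy, cornerGF]

lemma cornerGF_joined_succ : cornerGF a b c (k + 1) joined
    = 2 * cornerGF a b c k joined ^ 2 * ∑ j, cornerGF a b c k (alone j) := by
  rw [cornerGF_succ, combinations_joined]
  simp only [Fin.sum_univ_three, Multiset.insert_eq_cons, Multiset.map_add, Multiset.map_nsmul,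
    Multiset.map_cons, Multiset.map_singleton, Multiset.prod_cons, Multiset.prod_singleton,
    Multiset.sum_add, Multiset.sum_nsmul, Multiset.sum_singleton, nsmul_eq_mul, Nat.cast_ofNat]
  ring

lemma cornerGF_alone_succ (i : Fin 3) : cornerGF a b c (k + 1) (alone i)
    = cornerGF a b c k joined * cornerGF a b c k (alone i)
        * (2 * ∑ j, cornerGF a b c k (alone j) + cornerGF a b c k (alone i))
      + cornerGF a b c k joined ^ 2 * cornerGF a b c k discrete := by
  rw [cornerGF_succ, combinations_alone]
  simp only [Fin.sum_univ_three, Multiset.insert_eq_cons, Multiset.map_add, Multiset.map_nsmul,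
    Multiset.map_cons, Multiset.map_singleton, Multiset.prod_cons, Multiset.prod_singleton,
    Multiset.sum_add, Multiset.sum_nsmul, Multiset.sum_singleton, nsmul_eq_mul, Nat.cast_ofNat]
  ring

lemma cornerGF_discrete_succ : cornerGF a b c (k + 1) discrete
    = 4 * cornerGF a b c k joined * cornerGF a b c k discrete * ∑ j, cornerGF a b c k (alone j)
      + 2 * ∑ j, cornerGF a b c k (alone j) ^ 2
          * (cornerGF a b c k (alone (j + 1)) + cornerGF a b c k (alone (j + 2)))
      + 2 * ∏ j, cornerGF a b c k (alone j) := by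
  rw [cornerGF_succ, combinations_discrete]
  simp only [Fin.sum_univ_three, Fin.prod_univ_three, Multiset.insert_eq_cons, Multiset.map_add,
    Multiset.map_nsmul, Multiset.map_cons, Multiset.map_singleton, Multiset.prod_cons,
    Multiset.prod_singleton, Multiset.sum_add, Multiset.sum_nsmul, Multiset.sum_singleton,
    nsmul_eq_mul, Nat.cast_ofNat, Fin.reduceAdd, zero_add]
  ring

lemma cornerGF_zero_joined : cornerGF a b c 0 joined = a * b + a * c + b * c := by
  rw [cornerGF, gasket_zero, show corners 0 = cornersEquiv from rfl, rootedGF_triangle_joined]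
  have h_erase (i : Fin 3) : (Finset.univ.filter fun j => j ≠ i) = {i + 1, i + 2} := by
    revert i
    decide
  have h_ne (i : Fin 3) : i + 1 ≠ i + 2 := by
    revert i
    decide
  simp only [dirLabel_cornersEquiv, h_erase, Finset.prod_pair (h_ne _), Fin.sum_univ_three,
    Fin.reduceAdd, zero_add, Matrix.cons_val]
  ring

lemma cornerGF_zero_alone (i : Fin 3) : cornerGF a b c 0 (alone i) = ![c, a, b] i := by
  rw [cornerGF, gasket_zero, show corners 0 = cornersEquiv from rfl, rootedGF_triangle_alone,
    dirLabel_cornersEquiv]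

lemma cornerGF_zero_discrete : cornerGF a b c 0 discrete = 1 := by
  rw [cornerGF, gasket_zero, show corners 0 = cornersEquiv from rfl, rootedGF_triangle_discrete]

lemma T_succ : T a b c (k + 1) = cornerGF a b c k joined := by
  simp only [T, cornerGF, rootedGF, setoid_joined]
  exact congrArg _ (funext fun _ => propext isRootedForest_top_iff_isSpanningTree.symm)

lemma genFun_isSpanningForest {n : ℕ} {p : Pattern} {φ : Setoid (Fin 3) → Prop}
    (hn : Nat.card (Quotient p.setoid) = n) (hφ : ∀ q : Pattern, q = p ↔ φ q.setoid) :
    genFun (dirLabel a b c k) (fun H => IsSpanningForest (gasket k) n H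
      ∧ φ (H.reachableSetoid.comap (corners k))) = cornerGF a b c k p := by
  rw [cornerGF, rootedGF]
  refine congrArg _ (funext fun H => propext ?_)
  rw [isRootedForest_iff_isSpanningForest, hn, eq_setoid_iff hφ]

lemma U_succ : U a b c (k + 1) = cornerGF a b c k (alone 2) :=
  genFun_isSpanningForest a b c k (φ := fun s => s 0 1 ∧ ¬ s 0 2)
    (by rw [card_quotient_pairSetoid]; decide) (by decide)

lemma R_succ : R a b c (k + 1) = cornerGF a b c k (alone 1) :=
  genFun_isSpanningForest a b c k (φ := fun s => s 0 2 ∧ ¬ s 0 1)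
    (by rw [card_quotient_pairSetoid]; decide) (by decide)

lemma L_succ : L a b c (k + 1) = cornerGF a b c k (alone 0) :=
  genFun_isSpanningForest a b c k (φ := fun s => s 1 2 ∧ ¬ s 1 0)
    (by rw [card_quotient_pairSetoid]; decide) (by decide)

lemma Q_succ : Q a b c (k + 1) = cornerGF a b c k discrete :=
  genFun_isSpanningForest a b c k (φ := fun s => ¬ s 0 1 ∧ ¬ s 0 2 ∧ ¬ s 1 2)
    (by rw [card_quotient_pairSetoid]; decide) (by decide)

end CornerForests

end Sierpinski

theorem mainTheorem10 {K : Type*} [CommRing K] (a b c : K) :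
    (∀ n : ℕ, 1 ≤ n →
      Sierpinski.T a b c (n + 1)
          = 2 * Sierpinski.T a b c n ^ 2
            * (Sierpinski.U a b c n + Sierpinski.R a b c n + Sierpinski.L a b c n) ∧
      Sierpinski.U a b c (n + 1)
          = Sierpinski.T a b c n * Sierpinski.U a b c n
            * (2 * Sierpinski.R a b c n + 2 * Sierpinski.L a b c n + 3 * Sierpinski.U a b c n)
            + Sierpinski.T a b c n ^ 2 * Sierpinski.Q a b c n ∧
      Sierpinski.R a b c (n + 1)
          = Sierpinski.T a b c n * Sierpinski.R a b c n
            * (2 * Sierpinski.L a b c n + 2 * Sierpinski.U a b c n + 3 * Sierpinski.R a b c n)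
            + Sierpinski.T a b c n ^ 2 * Sierpinski.Q a b c n ∧
      Sierpinski.L a b c (n + 1)
          = Sierpinski.T a b c n * Sierpinski.L a b c n
            * (2 * Sierpinski.R a b c n + 2 * Sierpinski.U a b c n + 3 * Sierpinski.L a b c n)
            + Sierpinski.T a b c n ^ 2 * Sierpinski.Q a b c n ∧
      Sierpinski.Q a b c (n + 1)
          = 4 * Sierpinski.T a b c n * Sierpinski.Q a b c n
            * (Sierpinski.U a b c n + Sierpinski.R a b c n + Sierpinski.L a b c n)
            + 2 * (Sierpinski.U a b c n ^ 2 * (Sierpinski.R a b c n + Sierpinski.L a b c n)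
              + Sierpinski.R a b c n ^ 2 * (Sierpinski.L a b c n + Sierpinski.U a b c n)
              + Sierpinski.L a b c n ^ 2 * (Sierpinski.R a b c n + Sierpinski.U a b c n))
            + 2 * Sierpinski.U a b c n * Sierpinski.R a b c n * Sierpinski.L a b c n) ∧
    Sierpinski.T a b c 1 = a * b + a * c + b * c ∧
    Sierpinski.U a b c 1 = b ∧
    Sierpinski.R a b c 1 = a ∧
    Sierpinski.L a b c 1 = c ∧
    Sierpinski.Q a b c 1 = 1 := by
  refine ⟨fun n hn => ?_, ?_, ?_, ?_, ?_, ?_⟩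
  · obtain ⟨k, rfl⟩ := Nat.exists_eq_add_of_le' hn
    simp only [Sierpinski.T_succ, Sierpinski.U_succ, Sierpinski.R_succ, Sierpinski.L_succ,
      Sierpinski.Q_succ, Sierpinski.cornerGF_joined_succ, Sierpinski.cornerGF_alone_succ,
      Sierpinski.cornerGF_discrete_succ, Fin.sum_univ_three, Fin.prod_univ_three, Fin.reduceAdd]
    refine ⟨?_, ?_, ?_, ?_, ?_⟩ <;> ring
  · exact (Sierpinski.T_succ a b c 0).trans (Sierpinski.cornerGF_zero_joined a b c)
  · exact (Sierpinski.U_succ a b c 0).trans (Sierpinski.cornerGF_zero_alone a b c 2)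
  · exact (Sierpinski.R_succ a b c 0).trans (Sierpinski.cornerGF_zero_alone a b c 1)
  · exact (Sierpinski.L_succ a b c 0).trans (Sierpinski.cornerGF_zero_alone a b c 0)
  · exact (Sierpinski.Q_succ a b c 0).trans (Sierpinski.cornerGF_zero_discrete a b c)
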